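/- A body in $\mathbb R^2$ is a compact convex set with nonempty interior. Let $K,C\subset\mathbb R^2$ be bodies with $C=-C$. Set $$s(K)=\inf\{\rho>0:\ K-c\subset\rho(c-K)\text{ for some }c\in\mathbb R^2\},$$ $$R(K,C)=\inf\{\rho>0:\ K\subset\rho C+t\text{ for some }t\in\mathbb R^2\},\qquad r(K,C)=\sup\{\rho>0:\ \rho C\subset K+t\text{ for some }t\in\mathbb R^2\},$$ $$b_u(K,C)=\frac{\max_{x,y\in K}u^T(x-y)}{\max_{x\in C}u^Tx}\quad(u\neq0),\qquad D(K,C)=\max_{u\ne0}b_u(K,C),\qquad w(K,C)=\min_{u\neq0}b_u(K,C).$$ $K$ is called pseudo-complete with respect to $C$ if $r(K,C)+R(K,C)=D(K,C)$. Theorem. If $K$ is pseudo-complete with respect to $C$, then $$\frac{D(K,C)}{w(K,C)}\le\min\left\{\frac{s(K)+1}{2},\ \frac{s(K)^2}{s(K)^2-1}\right\},$$ where for $s(K)=1$ the second term is read as $+\infty$. Consequently, for every such $K$ and $C$, $$\frac{D(K,C)}{w(K,C)}\le\beta:=\frac16\left(4+\sqrt[3]{19-3\sqrt{33}}+\sqrt[3]{19+3\sqrt{33}}\right)\approx1.42$$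 (precisely, $|\beta-1.42|<0.005$), and $\beta=\frac{\tilde s+1}{2}$, where $\tilde s$ is the unique solution in $(1,\infty)$ of $\frac{s+1}{2}=\frac{s^2}{s^2-1}$. -/

import Mathlib

open scoped Pointwise

/-- `A ⊂ₜ B`: some translate of `B` contains `A`, i.e. `A ⊆ B + t` for some `t`. -/
def SubsetUpToTranslation {E : Type*} [AddCommGroup E] (A B : Set E) : Prop :=
  ∃ t : E, A ⊆ B + {t}

/-- The Minkowski asymmetry
`s(K) = inf {ρ > 0 : K - c ⊆ ρ (c - K) for some c}`. -/
noncomputable def minkowskiAsymmetry {E : Type*} [AddCommGroup E] [Module ℝ E] (K : Set E) : ℝ :=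
  sInf {ρ : ℝ | 0 < ρ ∧ ∃ c : E, K - {c} ⊆ ρ • ({c} - K)}

/-- The circumradius `R(K, C) = inf {ρ > 0 : K ⊂ₜ ρ C}`. -/
noncomputable def circumradius {E : Type*} [AddCommGroup E] [Module ℝ E] (K C : Set E) : ℝ :=
  sInf {ρ : ℝ | 0 < ρ ∧ SubsetUpToTranslation K (ρ • C)}

/-- The inradius `r(K, C) = sup {ρ > 0 : ρ C ⊂ₜ K}`. -/
noncomputable def inradius {E : Type*} [AddCommGroup E] [Module ℝ E] (K C : Set E) : ℝ :=
  sSup {ρ : ℝ | 0 < ρ ∧ SubsetUpToTranslation (ρ • C) K}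

/-- The breadth of `K` with respect to `C` in direction `u`,
`b_u(K, C) = max_{x, y ∈ K} ⟨u, x - y⟩ / max_{x ∈ C} ⟨u, x⟩`. The suprema are maxima when `K` and
`C` are compact and nonempty. -/
noncomputable def breadth {E : Type*} [NormedAddCommGroup E] [InnerProductSpace ℝ E]
    (u : E) (K C : Set E) : ℝ :=
  sSup {a : ℝ | ∃ x ∈ K, ∃ y ∈ K, a = inner ℝ u (x - y)} /
    sSup {a : ℝ | ∃ x ∈ C, a = inner ℝ u x}

/-- The width `w(K, C)`, the minimal breadth of `K` with respect to `C`. The infimum is a minimum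
for convex bodies `K`, `C` with `C` symmetric about the origin. -/
noncomputable def relWidth {E : Type*} [NormedAddCommGroup E] [InnerProductSpace ℝ E]
    (K C : Set E) : ℝ :=
  sInf {b : ℝ | ∃ u : E, u ≠ 0 ∧ b = breadth u K C}

/-- The diameter `D(K, C)`, the maximal breadth of `K` with respect to `C`. The supremum is a
maximum for convex bodies `K`, `C` with `C` symmetric about the origin. -/
noncomputable def relDiameter {E : Type*} [NormedAddCommGroup E] [InnerProductSpace ℝ E]
    (K C : Set E) : ℝ :=
  sSup {b : ℝ | ∃ u : E, u ≠ 0 ∧ b = breadth u K C}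

/-- `K` is pseudo-complete with respect to `C` if `r(K, C) + R(K, C) = D(K, C)`. -/
def IsPseudoComplete {E : Type*} [NormedAddCommGroup E] [InnerProductSpace ℝ E]
    (K C : Set E) : Prop :=
  inradius K C + circumradius K C = relDiameter K C

/-- The constant `(4 + ∛(19 - 3√33) + ∛(19 + 3√33)) / 6`; both radicands are positive. -/
noncomputable def ratioBound : ℝ :=
  1 / 6 * (4 + (19 - 3 * Real.sqrt 33) ^ (1 / 3 : ℝ) + (19 + 3 * Real.sqrt 33) ^ (1 / 3 : ℝ))

/-- A (full-dimensional) convex body: a compact convex set with nonempty interior. -/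
def IsFullConvexBody {E : Type*} [NormedAddCommGroup E] [InnerProductSpace ℝ E]
    (K : Set E) : Prop :=
  Convex ℝ K ∧ IsCompact K ∧ (interior K).Nonempty

open scoped Pointwise

/-! Translate `K` so that `rC ⊆ K`, and write `h_K`, `h_C` for support functions. Since `h_K(u) +
h_K(-u) ≤ D h_C(u)` and `h_K(-u) ≥ r h_C(u)`, also `K ⊆ (D - r)C = RC`, so `K ⊆ (R/r)(-K)`. The
general bound `R ≤ s/(s+1) D` shows that `R/r` is optimal. Hence `s = R/r`, `D = (s+1)r`, and the
origin is a Minkowski centre (`IsPseudoComplete.exists_centre`). With `w ≥ 2r` this gives `(s+1)/2`.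

For the other bound, `rC ⊆ K ∩ -K`. In the plane, for `s > 1`, `K ∩ -K` lies in `s/(s²-1)` times
`conv(K ∪ -K)` (`inner_mul_le_max_supportFun`), so `max(h_K(u), h_K(-u)) ≥ r h_C(u) (s²-1)/s`. As
the smaller of `h_K(±u)` is at least `1/s` of the larger, every breadth is at least `D(s²-1)/s²`.
The planar inclusion comes from three touching normals with the origin in their convex hull, and
reduces to `triangle_estimate`.

One bound increases in `s` and the other decreases; they cross at the root of `s³ - s² - s - 1`. -/

/-! ### The crossing point of the two bounds. -/

theorem tribonacci_iff {s : ℝ} (hs : 1 < s) :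
    (s + 1) / 2 = s ^ 2 / (s ^ 2 - 1) ↔ s ^ 3 - s ^ 2 - s - 1 = 0 := by
  have h : 0 < s ^ 2 - 1 := by nlinarith
  rw [div_eq_div_iff two_ne_zero h.ne']
  constructor <;> intro h <;> linarith

/-- Cardano's formula for the tribonacci constant, written in terms of `ratioBound`. -/
theorem ratioBound_cubic :
    (2 * ratioBound - 1) ^ 3 - (2 * ratioBound - 1) ^ 2 - (2 * ratioBound - 1) - 1 = 0 := by
  set q := Real.sqrt 33 with hq
  have hqq : q ^ 2 = 33 := Real.sq_sqrt (by norm_num)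
  have hq0 : 0 ≤ q := Real.sqrt_nonneg _
  have hq6 : q < 6 := by nlinarith
  have hx : 0 ≤ 19 - 3 * q := by linarith
  have hy : 0 ≤ 19 + 3 * q := by linarith
  set a := (19 - 3 * q) ^ (1 / 3 : ℝ) with ha
  set b := (19 + 3 * q) ^ (1 / 3 : ℝ) with hb
  have ha3 : a ^ 3 = 19 - 3 * q := by
    rw [ha, ← Real.rpow_natCast, ← Real.rpow_mul hx]; norm_num
  have hb3 : b ^ 3 = 19 + 3 * q := by
    rw [hb, ← Real.rpow_natCast, ← Real.rpow_mul hy]; norm_num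
  have hab : a * b = 4 := by
    rw [ha, hb, ← Real.mul_rpow hx hy,
      show (19 - 3 * q) * (19 + 3 * q) = 4 ^ (3 : ℝ) by norm_num; linarith,
      ← Real.rpow_mul (by norm_num)]
    norm_num
  have hr : 2 * ratioBound - 1 = (1 + a + b) / 3 := by
    simp only [ratioBound, ← hq, ← ha, ← hb]; ring
  rw [hr]
  linear_combination (1 / 27) * ha3 + (1 / 27) * hb3 + (1 / 9) * (a + b) * hab

/-- The cubic equals `(x - 1)²(x + 1) - 2`. -/
theorem tribonacci_strictMono {s t : ℝ} (hs : 1 ≤ s) (hst : s < t) :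
    s ^ 3 - s ^ 2 - s - 1 < t ^ 3 - t ^ 2 - t - 1 := by
  nlinarith [mul_pos (sub_pos.2 hst) (sub_pos.2 (hs.trans_lt hst)),
    mul_nonneg (sub_nonneg.2 hst.le) (sub_nonneg.2 hs),
    mul_nonneg (mul_nonneg (sub_nonneg.2 hst.le) (sub_nonneg.2 hs)) (sub_nonneg.2 (hs.trans hst.le)),
    mul_nonneg (sub_nonneg.2 hst.le) (sq_nonneg (t - 1)),
    mul_nonneg (sub_nonneg.2 hst.le) (sq_nonneg (s - 1))]

theorem ratioBound_mem : 1.418 < ratioBound ∧ ratioBound < 1.422 := by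
  have h := ratioBound_cubic
  -- Below 1 there is no root: `(x - 1)²(x + 1) ≤ 32/27 < 2` there.
  have h1 : 1 ≤ 2 * ratioBound - 1 := by
    by_contra hlt
    push Not at hlt
    nlinarith [sq_nonneg (2 * ratioBound - 1), sq_nonneg (2 * ratioBound - 1 + 1),
      mul_nonneg (sub_nonneg.2 hlt.le) (sq_nonneg (2 * ratioBound - 1 + 1))]
  constructor
  · by_contra hle
    push Not at hle
    rcases hle.eq_or_lt with he | hlt
    · rw [he] at h; norm_num at h
    · have := tribonacci_strictMono h1 (by linarith : 2 * ratioBound - 1 < 2 * 1.418 - 1)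
      rw [h] at this; norm_num at this
  · by_contra hle
    push Not at hle
    rcases hle.eq_or_lt with he | hlt
    · rw [← he] at h; norm_num at h
    · have := tribonacci_strictMono (by norm_num) (by linarith : 2 * 1.422 - 1 < 2 * ratioBound - 1)
      rw [h] at this; norm_num at this

theorem ratioBound_eq_iff {s : ℝ} (hs : 1 < s) :
    (s + 1) / 2 = s ^ 2 / (s ^ 2 - 1) ↔ ratioBound = (s + 1) / 2 := by
  rw [tribonacci_iff hs]
  have hb := ratioBound_mem.1
  have hc := ratioBound_cubic
  constructor
  · intro h
    have key : s = 2 * ratioBound - 1 := by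
      rcases lt_trichotomy s (2 * ratioBound - 1) with hlt | he | hlt
      · linarith [tribonacci_strictMono hs.le hlt]
      · exact he
      · linarith [tribonacci_strictMono (by linarith) hlt]
    linarith
  · intro h
    rw [h] at hc
    rwa [show 2 * ((s + 1) / 2) - 1 = s by ring] at hc

/-- Left of the crossing point the increasing bound suffices, right of it the decreasing one. -/
theorem le_ratioBound {s q : ℝ} (hs : 1 ≤ s) (h₁ : q ≤ (s + 1) / 2)
    (h₂ : s ≠ 1 → q ≤ s ^ 2 / (s ^ 2 - 1)) : q ≤ ratioBound := by
  rcases le_or_gt s (2 * ratioBound - 1) with hle | hlt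
  · linarith
  · have hb := ratioBound_mem.1
    have hs1 : 1 < s := by linarith
    have hpos : 0 < s ^ 2 - 1 := by nlinarith
    refine (h₂ hs1.ne').trans ?_
    set t := 2 * ratioBound - 1 with ht
    have htr : ratioBound = (t + 1) / 2 := by rw [ht]; ring
    have ht1 : 1 < t := by linarith
    have htpos : 0 < t ^ 2 - 1 := by nlinarith
    rw [htr, (tribonacci_iff ht1).2 ratioBound_cubic, div_le_div_iff₀ hpos htpos]
    nlinarith

/-! ### The planar estimate in coordinates. -/

/-- A tangent-line estimate for the convex function `z ↦ (s - z) / (s² + 1 - 2 s z)` at `s / 2`. -/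
theorem tangent_le_div {s y z : ℝ} (hs : 1 < s) (hz : z ≤ 1) (hy : 0 < y) (hyz : s ≤ y + z) :
    s / 2 + (s ^ 2 - 1) * (z - s / 2) ≤ y / ((s - 1) * y + (s + 1) * (1 - z)) := by
  have hd : 0 < (s - 1) * y + (s + 1) * (1 - z) :=
    add_pos_of_pos_of_nonneg (mul_pos (by linarith) hy) (mul_nonneg (by linarith) (by linarith))
  have he : 0 < s ^ 2 + 1 - 2 * s * z := by nlinarith
  have h₁ : s / 2 + (s ^ 2 - 1) * (z - s / 2) ≤ (s - z) / (s ^ 2 + 1 - 2 * s * z) := by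
    rw [le_div_iff₀ he]
    have : 0 ≤ 2 * s * (s ^ 2 - 1) * (z - s / 2) ^ 2 :=
      mul_nonneg (mul_nonneg (by linarith) (by nlinarith)) (sq_nonneg _)
    linarith
  -- The quotient increases with `y`; at `y = s - z` its denominator is `s² + 1 - 2sz`.
  refine h₁.trans ?_
  rw [div_le_div_iff₀ he hd]
  have : 0 ≤ (s + 1) * (1 - z) * (y - (s - z)) :=
    mul_nonneg (mul_nonneg (by linarith) (by linarith)) (by linarith)
  linarith

/-- The planar estimate behind the bound `s² / (s² - 1)`, in coordinates: `lᵢ` are the barycentric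
coordinates of the origin in a circumscribed triangle, `Pᵢⱼ` the values of the `j`-th edge
functional at the `i`-th touching point. -/
theorem triangle_estimate {s l₁ l₂ l₃ P₁₂ P₁₃ P₂₁ P₂₃ α β M : ℝ} (hs : 1 < s)
    (hsum : l₁ + l₂ + l₃ = 1) (h₁ : l₁ * (s + 1) ≤ 1) (h₂ : l₂ * (s + 1) ≤ 1)
    (h₃ : l₃ * (s + 1) ≤ 1)
    (hP₁₃ : -1 ≤ P₁₃) (hP₂₃ : -1 ≤ P₂₃)
    (e₁ : l₁ * s + l₂ * P₁₂ + l₃ * P₁₃ = 0) (e₂ : l₁ * P₂₁ + l₂ * s + l₃ * P₂₃ = 0)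
    (hα : 0 ≤ α) (hβ : 0 ≤ β) (hM₁ : α * s - β * P₁₂ ≤ M) (hM₂ : β * s - α * P₂₁ ≤ M) :
    (α + β) * ((s ^ 2 - 1) / s) ≤ M := by
  have hs0 : 0 < s + 1 := by linarith
  set z := l₁ * (s + 1) with hz
  set y := l₂ * (s + 1) with hy
  have hyz : s ≤ y + z := by
    have : y + z + l₃ * (s + 1) = s + 1 := by rw [hz, hy]; linear_combination (s + 1) * hsum
    linarith
  have hy0 : 0 < y := by linarith
  have hz0 : 0 < z := by linarith
  have hl₁ : 0 < l₁ := pos_of_mul_pos_left hz0 hs0.le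
  have hl₂ : 0 < l₂ := pos_of_mul_pos_left hy0 hs0.le
  have hl₃ : 0 ≤ l₃ := by
    by_contra h
    push Not at h
    nlinarith
  have hA : y * (P₁₂ + 1) ≤ (s + 1) * (1 - z) := by
    have : l₂ * (P₁₂ + 1) ≤ 1 - z := by
      rw [hz]; linarith [mul_le_mul_of_nonneg_left hP₁₃ hl₃]
    rw [hy]; linarith [mul_le_mul_of_nonneg_left this hs0.le]
  have hB : z * (P₂₁ + 1) ≤ (s + 1) * (1 - y) := by
    have : l₁ * (P₂₁ + 1) ≤ 1 - y := by
      rw [hy]; linarith [mul_le_mul_of_nonneg_left hP₂₃ hl₃]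
    rw [hz]; linarith [mul_le_mul_of_nonneg_left this hs0.le]
  set d₁ := (s - 1) * y + (s + 1) * (1 - z) with hd₁
  set d₂ := (s - 1) * z + (s + 1) * (1 - y) with hd₂
  have hd₁0 : 0 < d₁ :=
    add_pos_of_pos_of_nonneg (mul_pos (by linarith) hy0) (mul_nonneg (by linarith) (by linarith))
  have hd₂0 : 0 < d₂ :=
    add_pos_of_pos_of_nonneg (mul_pos (by linarith) hz0) (mul_nonneg (by linarith) (by linarith))
  -- The two tangent lines add up to `s + (s² - 1)(y + z - s)`.
  have hS : s ≤ y / d₁ + z / d₂ := by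
    have h1 := tangent_le_div hs h₁ hy0 hyz
    have h2 := tangent_le_div hs h₂ hz0 (by linarith)
    have h3 : 0 ≤ (s ^ 2 - 1) * (y + z - s) := mul_nonneg (by nlinarith) (by linarith)
    rw [← hd₁] at h1
    rw [← hd₂] at h2
    linarith
  -- `hM₁` gives `(α + β)s - M ≤ β(s + P₁₂)`, and `hA` gives `y(s + P₁₂) ≤ d₁`.
  have k₁ : ((α + β) * s - M) * y ≤ β * d₁ := by
    rw [hd₁]
    linarith [mul_le_mul_of_nonneg_left hM₁ hy0.le, mul_le_mul_of_nonneg_left hA hβ]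
  have k₂ : ((α + β) * s - M) * z ≤ α * d₂ := by
    rw [hd₂]
    linarith [mul_le_mul_of_nonneg_left hM₂ hz0.le, mul_le_mul_of_nonneg_left hB hα]
  have k : ((α + β) * s - M) * (y / d₁ + z / d₂) ≤ α + β := by
    have i₁ := (div_le_iff₀ hd₁0).2 k₁
    have i₂ := (div_le_iff₀ hd₂0).2 k₂
    rw [mul_div_assoc] at i₁ i₂
    rw [mul_add]
    exact (add_le_add i₁ i₂).trans_eq (add_comm β α)
  have key : ((α + β) * s - M) * s ≤ α + β := by
    rcases le_or_gt 0 ((α + β) * s - M) with h | h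
    · exact (mul_le_mul_of_nonneg_left hS h).trans k
    · nlinarith
  rw [← mul_div_assoc, div_le_iff₀ (by linarith)]
  linarith

/-! ### Compactness of convex hulls. -/

/-- By Carathéodory the hull is a continuous image of a simplex times a power of `s`; shorter
combinations are padded with weight 0 at `a`. -/
theorem IsCompact.isCompact_convexHull {E : Type*} [NormedAddCommGroup E] [NormedSpace ℝ E]
    [FiniteDimensional ℝ E] {s : Set E} (hs : IsCompact s) : IsCompact (convexHull ℝ s) := by
  rcases s.eq_empty_or_nonempty with rfl | ⟨a, ha⟩
  · simp
  set n := Module.finrank ℝ E + 1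
  have hcomp : IsCompact (stdSimplex ℝ (Fin n) ×ˢ Set.univ.pi fun _ : Fin n => s) :=
    (isCompact_stdSimplex ℝ (Fin n)).prod (isCompact_univ_pi fun _ => hs)
  have himg := hcomp.image (f := fun p : (Fin n → ℝ) × (Fin n → E) => ∑ i, p.1 i • p.2 i)
    (by fun_prop)
  convert himg using 1
  apply Set.Subset.antisymm
  · intro x hx
    obtain ⟨ι, _, z, w, hz, hind, hw, hw1, hx⟩ := eq_pos_convex_span_of_mem_convexHull hx
    have hcard : Fintype.card ι ≤ Fintype.card (Fin n) := by
      rw [Fintype.card_fin]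
      exact hind.card_le_finrank_succ.trans (Nat.add_le_add_right (Submodule.finrank_le _) 1)
    obtain ⟨e⟩ := Function.Embedding.nonempty_of_card_le hcard
    refine ⟨(Function.extend e w 0, Function.extend e z fun _ => a),
      ⟨⟨fun j => ?_, ?_⟩, fun j _ => ?_⟩, ?_⟩
    · by_cases hj : ∃ i, e i = j
      · obtain ⟨i, rfl⟩ := hj
        simpa [e.injective.extend_apply] using (hw i).le
      · simp [Function.extend_apply' _ _ _ hj]
    · rw [← hw1]
      exact (Fintype.sum_of_injective e e.injective w (Function.extend e w 0)
        (fun j hj => Function.extend_apply' w (0 : Fin n → ℝ) j hj)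
        fun i => (e.injective.extend_apply _ _ _).symm).symm
    · by_cases hj : ∃ i, e i = j
      · obtain ⟨i, rfl⟩ := hj
        simpa [e.injective.extend_apply] using hz ⟨i, rfl⟩
      · simpa [Function.extend_apply' _ _ _ hj] using ha
    · rw [← hx]
      refine (Fintype.sum_of_injective e e.injective _ _ (fun j hj => ?_) fun i => ?_).symm
      · simp [Function.extend_apply' w (0 : Fin n → ℝ) j hj]
      · simp [e.injective.extend_apply]
  · rintro _ ⟨⟨w, z⟩, ⟨hw, hz⟩, rfl⟩
    exact (convex_convexHull ℝ s).sum_mem (fun i _ => hw.1 i) hw.2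
      fun i _ => subset_convexHull ℝ s (hz i trivial)

/-! ### Support functions. -/

section SupportFunction

variable {E : Type*} [NormedAddCommGroup E] [InnerProductSpace ℝ E]

/-- The support function `h_K(u) = sup {⟨u, x⟩ : x ∈ K}`. -/
noncomputable def supportFun (K : Set E) (u : E) : ℝ :=
  sSup ((fun x => inner ℝ u x) '' K)

theorem IsCompact.bddAbove_inner {K : Set E} (hK : IsCompact K) (u : E) :
    BddAbove ((fun x => inner ℝ u x) '' K) :=
  (hK.image (by fun_prop)).bddAbove

theorem IsCompact.inner_le_supportFun {K : Set E} (hK : IsCompact K) (u : E) {x : E}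
    (hx : x ∈ K) : inner ℝ u x ≤ supportFun K u :=
  le_csSup (hK.bddAbove_inner u) ⟨x, hx, rfl⟩

theorem supportFun_le {K : Set E} (hK : K.Nonempty) {u : E} {a : ℝ}
    (h : ∀ x ∈ K, inner ℝ u x ≤ a) : supportFun K u ≤ a :=
  csSup_le (hK.image _) (by rintro _ ⟨x, hx, rfl⟩; exact h x hx)

theorem IsCompact.exists_inner_eq_supportFun {K : Set E} (hK : IsCompact K) (hne : K.Nonempty)
    (u : E) : ∃ x ∈ K, inner ℝ u x = supportFun K u := by
  obtain ⟨x, hx, h⟩ := hK.exists_sSup_image_eq hne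
    (f := fun x => inner ℝ u x) (by fun_prop)
  exact ⟨x, hx, h.symm⟩

theorem IsCompact.continuous_supportFun {K : Set E} (hK : IsCompact K) :
    Continuous (supportFun K) :=
  hK.continuous_sSup (f := fun u x : E => (inner ℝ u x : ℝ)) continuous_inner

theorem supportFun_smul (K : Set E) {c : ℝ} (hc : 0 ≤ c) (u : E) :
    supportFun K (c • u) = c * supportFun K u := by
  have := Real.sSup_smul_of_nonneg hc ((fun x => inner ℝ u x) '' K)
  rw [smul_eq_mul] at this
  rw [supportFun, supportFun, ← this, ← Set.image_smul, Set.image_image]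
  simp [real_inner_smul_left]

theorem supportFun_neg_of_symm {C : Set E} (hC : -C = C) (u : E) :
    supportFun C (-u) = supportFun C u := by
  rw [supportFun, supportFun]
  conv_lhs => rw [← hC, ← Set.image_neg_eq_neg, Set.image_image]
  simp

theorem IsCompact.supportFun_add_singleton {K : Set E} (hK : IsCompact K) (hne : K.Nonempty)
    (t u : E) : supportFun (K + {t}) u = supportFun K u + inner ℝ u t := by
  apply le_antisymm
  · refine supportFun_le (hne.add (Set.singleton_nonempty t)) ?_
    rintro _ ⟨x, hx, _, rfl, rfl⟩
    simp only [inner_add_right]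
    gcongr
    exact hK.inner_le_supportFun u hx
  · obtain ⟨x, hx, h⟩ := hK.exists_inner_eq_supportFun hne u
    rw [← h, ← inner_add_right]
    exact (hK.add isCompact_singleton).inner_le_supportFun u (Set.add_mem_add hx rfl)

/-- A closed convex set is the intersection of its supporting half-spaces. -/
theorem mem_of_forall_inner_le_supportFun [CompleteSpace E] {K : Set E} (hK : IsCompact K)
    (hconv : Convex ℝ K) (hne : K.Nonempty) {x : E}
    (h : ∀ u : E, inner ℝ u x ≤ supportFun K u) : x ∈ K := by
  by_contra hx
  obtain ⟨f, a, hf, ha⟩ := geometric_hahn_banach_closed_point hconv hK.isClosed hx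
  set u := (InnerProductSpace.toDual ℝ E).symm f with hu
  have huf : ∀ y, inner ℝ u y = f y := fun y => InnerProductSpace.toDual_symm_apply
  have h₁ := h u
  have h₂ : supportFun K u ≤ a := supportFun_le hne fun y hy => by rw [huf]; exact (hf y hy).le
  rw [huf] at h₁
  linarith

theorem IsCompact.breadth_eq {K : Set E} (hK : IsCompact K) (hne : K.Nonempty) (C : Set E)
    (u : E) : breadth u K C = (supportFun K u + supportFun K (-u)) / supportFun C u := by
  have h₁ : sSup {a : ℝ | ∃ x ∈ K, ∃ y ∈ K, a = inner ℝ u (x - y)} =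
      supportFun K u + supportFun K (-u) := by
    apply IsLUB.csSup_eq
    · constructor
      · rintro _ ⟨x, hx, y, hy, rfl⟩
        have := hK.inner_le_supportFun u hx
        have := hK.inner_le_supportFun (-u) hy
        rw [inner_neg_left] at this
        rw [inner_sub_right]
        linarith
      · intro b hb
        obtain ⟨x, hx, hx'⟩ := hK.exists_inner_eq_supportFun hne u
        obtain ⟨y, hy, hy'⟩ := hK.exists_inner_eq_supportFun hne (-u)
        have := hb ⟨x, hx, y, hy, rfl⟩
        rw [inner_neg_left] at hy'
        rw [inner_sub_right] at this
        linarith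
    · obtain ⟨x, hx⟩ := hne
      exact ⟨_, x, hx, x, hx, rfl⟩
  have h₂ : {a : ℝ | ∃ x ∈ C, a = inner ℝ u x} = (fun x => inner ℝ u x) '' C := by
    ext a
    simp [eq_comm]
  rw [breadth, h₁, h₂]
  rfl

theorem exists_pos_mul_norm_le_supportFun {C : Set E} (hC : IsCompact C)
    (h : (0 : E) ∈ interior C) : ∃ ε > 0, ∀ u, ε * ‖u‖ ≤ supportFun C u := by
  obtain ⟨ε, hε, hball⟩ := Metric.nhds_basis_closedBall.mem_iff.1 (mem_interior_iff_mem_nhds.1 h)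
  refine ⟨ε, hε, fun u => ?_⟩
  rcases eq_or_ne u 0 with rfl | hu
  · simpa using hC.inner_le_supportFun 0 (interior_subset h)
  · have hu' : ‖u‖ ≠ 0 := norm_ne_zero_iff.2 hu
    have hm : (ε / ‖u‖) • u ∈ C := hball (by
      rw [mem_closedBall_zero_iff, norm_smul, norm_div, norm_norm, div_mul_cancel₀ _ hu',
        Real.norm_of_nonneg hε.le])
    have := hC.inner_le_supportFun u hm
    rw [real_inner_smul_right, real_inner_self_eq_norm_sq] at this
    refine le_trans (le_of_eq ?_) this
    field_simp

theorem Convex.zero_mem_interior_of_symm {C : Set E} (hC : Convex ℝ C) (hsymm : -C = C)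
    (h : (interior C).Nonempty) : (0 : E) ∈ interior C := by
  obtain ⟨x, hx⟩ := h
  have hx' : -x ∈ interior C := by
    refine interior_maximal (t := -interior C) ?_ isOpen_interior.neg (by simpa using hx)
    nth_rewrite 2 [← hsymm]
    exact Set.neg_subset_neg.2 interior_subset
  have := hC.interior.midpoint_mem hx hx'
  rwa [midpoint_self_neg] at this

end SupportFunction

/-! ### Minkowski centres and touching normals. -/

section Asymmetry

variable {E : Type*} [NormedAddCommGroup E] [InnerProductSpace ℝ E]

/-- Containment in a reflected dilate, expressed through support functions. -/
theorem sub_subset_smul_iff [CompleteSpace E] {K : Set E} (hK : IsCompact K)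
    (hconv : Convex ℝ K) (hne : K.Nonempty) {ρ : ℝ} (hρ : 0 < ρ) (c : E) :
    K - {c} ⊆ ρ • ({c} - K) ↔
      ∀ u, supportFun K u - inner ℝ u c ≤ ρ * (supportFun K (-u) + inner ℝ u c) := by
  constructor
  · intro h u
    obtain ⟨x, hx, hxu⟩ := hK.exists_inner_eq_supportFun hne u
    obtain ⟨_, ⟨_, rfl, y, hy, rfl⟩, hxy⟩ := h (Set.sub_mem_sub hx (Set.mem_singleton c))
    have h₁ := congrArg (inner ℝ u) hxy
    simp only [inner_sub_right, real_inner_smul_right] at h₁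
    have h₂ := hK.inner_le_supportFun (-u) hy
    rw [inner_neg_left] at h₂
    rw [← hxu, ← h₁]
    exact mul_le_mul_of_nonneg_left (by linarith) hρ.le
  · rintro h _ ⟨x, hx, _, rfl, rfl⟩
    rename_i c
    refine ⟨c - (c - ρ⁻¹ • (x - c)), Set.sub_mem_sub rfl ?_, ?_⟩
    · refine mem_of_forall_inner_le_supportFun hK hconv hne fun u => ?_
      have h₁ := h (-u)
      have h₂ := hK.inner_le_supportFun (-u) hx
      simp only [neg_neg, inner_neg_left] at h₁ h₂
      rw [inner_sub_right, real_inner_smul_right, inner_sub_right]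
      have h₃ : ρ⁻¹ * (inner ℝ u c - inner ℝ u x) ≤ supportFun K u - inner ℝ u c := by
        rw [inv_mul_le_iff₀ hρ]
        linarith
      linarith
    · simp [smul_smul, hρ.ne']

/-- If the containment `K ⊆ -s K` is optimal among all translates of `K`, then the origin is a
convex combination of outer normals of touching hyperplanes. -/
theorem zero_mem_convexHull_touching [FiniteDimensional ℝ E] {K : Set E} (hK : IsCompact K)
    (hconv : Convex ℝ K) (h0 : (0 : E) ∈ interior K) {s : ℝ} (hs : 0 < s)
    (hsub : ∀ u, supportFun K u ≤ s * supportFun K (-u))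
    (hmin : ∀ ρ : ℝ, 0 < ρ → ∀ c : E, K - {c} ⊆ ρ • ({c} - K) → s ≤ ρ) :
    (0 : E) ∈ convexHull ℝ {a : E | ‖a‖ = 1 ∧ supportFun K a = s * supportFun K (-a)} := by
  have hne : K.Nonempty := ⟨0, interior_subset h0⟩
  have hcont := hK.continuous_supportFun
  have hcont' : Continuous fun a => supportFun K (-a) := hcont.comp continuous_neg
  set N := {a : E | ‖a‖ = 1 ∧ supportFun K a = s * supportFun K (-a)} with hN
  set S : Set E := Metric.sphere 0 1 with hS
  have hScomp : IsCompact S := isCompact_sphere 0 1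
  have hNcomp : IsCompact N := by
    have : N = S ∩ {a | supportFun K a = s * supportFun K (-a)} := by ext a; simp [hN, hS]
    rw [this]
    exact hScomp.inter_right (isClosed_eq hcont (continuous_const.mul hcont'))
  by_contra hcon
  obtain ⟨f, v, hv0, hv⟩ := geometric_hahn_banach_point_closed (convex_convexHull ℝ N)
    hNcomp.isCompact_convexHull.isClosed hcon
  set c := (InnerProductSpace.toDual ℝ E).symm f with hc
  have hcf : ∀ y, inner ℝ y c = f y := fun y => by
    rw [real_inner_comm]; exact InnerProductSpace.toDual_symm_apply
  have hcN : ∀ a ∈ N, 0 < inner ℝ a c := fun a ha => by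
    rw [hcf]
    rw [map_zero] at hv0
    exact hv0.trans (hv a (subset_convexHull ℝ N ha))
  have hG : ∀ a ∈ S, inner ℝ a c ≤ 0 → 0 < s * supportFun K (-a) - supportFun K a := by
    intro a ha hac
    refine lt_of_le_of_ne (sub_nonneg.2 (hsub a)) fun h => ?_
    exact (hcN a ⟨by simpa [hS] using ha, by linarith⟩).not_ge hac
  -- Moving the centre along `c` relaxes the constraints with `⟨a, c⟩ > 0`; the others are strict
  -- with a uniform gap `δ` by compactness.
  obtain ⟨ε, hε, hstrict⟩ : ∃ ε > 0, ∀ a ∈ S,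
      0 < s * supportFun K (-a) - supportFun K a + ε * inner ℝ a c := by
    have hM : IsCompact (S ∩ {a | inner ℝ a c ≤ 0}) :=
      hScomp.inter_right (isClosed_le (by fun_prop) continuous_const)
    obtain ⟨δ, hδ, hδM⟩ := hM.exists_forall_le'
      (f := fun a => s * supportFun K (-a) - supportFun K a)
      ((continuous_const.mul hcont').sub hcont).continuousOn
      (a := 0) fun a ha => hG a ha.1 ha.2
    refine ⟨δ / (‖c‖ + 1), by positivity, fun a ha => ?_⟩
    have hε : 0 < δ / (‖c‖ + 1) := by positivity
    rcases le_or_gt (inner ℝ a c) 0 with h | h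
    · have h₁ := hδM a ⟨ha, h⟩
      have h₂ : -‖c‖ ≤ inner ℝ a c := by
        have := abs_real_inner_le_norm a c
        rw [show ‖a‖ = 1 by simpa [hS] using ha, one_mul] at this
        exact neg_le_of_abs_le this
      have h₃ : δ / (‖c‖ + 1) * ‖c‖ < δ := by
        rw [div_mul_eq_mul_div, div_lt_iff₀ (by positivity)]
        linarith
      have := mul_le_mul_of_nonneg_left h₂ hε.le
      linarith
    · have := hsub a
      have := mul_pos hε h
      linarith
  -- Shifting the centre by `e` changes the slack by `(s + 1)⟨a, e⟩`.
  set e : E := (ε / (s + 1)) • c with he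
  have hec : ∀ a, inner ℝ a e * (s + 1) = ε * inner ℝ a c := fun a => by
    rw [he, real_inner_smul_right]; field_simp
  obtain ⟨η, hη, hηS⟩ := hScomp.exists_forall_le'
    (f := fun a => s * supportFun K (-a) - supportFun K a + ε * inner ℝ a c)
    (by fun_prop) (a := 0) hstrict
  obtain ⟨M, hM⟩ := hScomp.bddAbove_image
    (f := fun a => supportFun K (-a) - inner ℝ a (-e)) (by fun_prop)
  have hM' : ∀ a ∈ S, supportFun K (-a) - inner ℝ a (-e) ≤ M := fun a ha => hM ⟨a, ha, rfl⟩
  -- The slack `η` allows a factor below `s`; `s / 2` only keeps it positive.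
  set ρ := max (s - η / (|M| + 1)) (s / 2) with hρ
  have hρ0 : 0 < ρ := lt_max_of_lt_right (by linarith)
  have hρs : ρ < s := max_lt (sub_lt_self _ (by positivity)) (by linarith)
  refine (hmin ρ hρ0 e ((sub_subset_smul_iff hK hconv hne hρ0 e).2 fun u => ?_)).not_gt hρs
  rcases eq_or_ne u 0 with rfl | hu
  · have := supportFun_smul K le_rfl (0 : E)
    simp only [smul_zero, zero_mul] at this
    simp [this]
  have hu' : 0 < ‖u‖ := norm_pos_iff.2 hu
  set a := ‖u‖⁻¹ • u with ha
  have hua : u = ‖u‖ • a := by rw [ha, smul_smul, mul_inv_cancel₀ hu'.ne', one_smul]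
  have haS : a ∈ S := by simp [hS, ha, norm_smul, hu'.ne']
  have key : supportFun K a - inner ℝ a e ≤ ρ * (supportFun K (-a) + inner ℝ a e) := by
    have h₁ := hηS a haS
    have h₂ := hM' a haS
    rw [inner_neg_right, sub_neg_eq_add] at h₂
    rw [← hec] at h₁
    set X := supportFun K (-a) + inner ℝ a e with hX
    have h₃ : supportFun K a - inner ℝ a e ≤ s * X - η := by rw [hX]; linarith
    have hX0 : 0 ≤ X := by
      have h₄ := hK.inner_le_supportFun a (interior_subset h0)
      have h₅ := hK.inner_le_supportFun (-a) (interior_subset h0)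
      rw [inner_zero_right] at h₄ h₅
      by_contra hneg
      push Not at hneg
      have h₆ : s * X < 0 := mul_neg_of_pos_of_neg hs hneg
      linarith
    have h₇ : η / (|M| + 1) * X ≤ η := by
      rw [div_mul_eq_mul_div, div_le_iff₀ (by positivity)]
      exact mul_le_mul_of_nonneg_left (by linarith [le_abs_self M]) hη.le
    have h₈ : (s - η / (|M| + 1)) * X ≤ ρ * X := mul_le_mul_of_nonneg_right (le_max_left _ _) hX0
    linarith
  rw [hua, ← smul_neg, supportFun_smul K hu'.le, supportFun_smul K hu'.le, real_inner_smul_left,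
    ← mul_sub, ← mul_add, mul_left_comm]
  exact mul_le_mul_of_nonneg_left key hu'.le

/-- On `K ∩ -K` each edge functional lies in `[-1, 1]`, so the left inner product is at most `α +
β`. The right side is tested at `p₁` and, with opposite sign, at `p₂`. -/
theorem inner_mul_le_of_triangle_pair {K : Set E} (hK : IsCompact K) {s : ℝ} (hs : 1 < s)
    {b₁ b₂ b₃ p₁ p₂ p₃ : E} {l₁ l₂ l₃ : ℝ} (hl₁ : 0 ≤ l₁) (hl₂ : 0 ≤ l₂) (hl₃ : 0 ≤ l₃)
    (hsum : l₁ + l₂ + l₃ = 1) (hb : l₁ • b₁ + l₂ • b₂ + l₃ • b₃ = 0)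
    (hp₁ : p₁ ∈ K) (hp₂ : p₂ ∈ K) (hp₃ : p₃ ∈ K)
    (hbp₁ : inner ℝ b₁ p₁ = s) (hbp₂ : inner ℝ b₂ p₂ = s) (hbp₃ : inner ℝ b₃ p₃ = s)
    (hK₁ : ∀ x ∈ K, -1 ≤ inner ℝ b₁ x) (hK₂ : ∀ x ∈ K, -1 ≤ inner ℝ b₂ x)
    (hK₃ : ∀ x ∈ K, -1 ≤ inner ℝ b₃ x) {α β : ℝ} (hα : 0 ≤ α) (hβ : 0 ≤ β)
    {x : E} (hx : x ∈ K) (hx' : -x ∈ K) :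
    inner ℝ (α • b₁ - β • b₂) x * ((s ^ 2 - 1) / s) ≤
      max (supportFun K (α • b₁ - β • b₂)) (supportFun K (-(α • b₁ - β • b₂))) := by
  have hz : ∀ p, l₁ * inner ℝ b₁ p + l₂ * inner ℝ b₂ p + l₃ * inner ℝ b₃ p = 0 := fun p => by
    have := congrArg (fun v => inner ℝ v p) hb
    simpa [inner_add_left, real_inner_smul_left] using this
  have e₁ := hz p₁
  have e₂ := hz p₂
  have e₃ := hz p₃
  rw [hbp₁] at e₁
  rw [hbp₂] at e₂
  rw [hbp₃] at e₃
  have hM₁ := hK.inner_le_supportFun (α • b₁ - β • b₂) hp₁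
  have hM₂ := hK.inner_le_supportFun (-(α • b₁ - β • b₂)) hp₂
  rw [inner_sub_left, real_inner_smul_left, real_inner_smul_left, hbp₁] at hM₁
  rw [inner_neg_left, inner_sub_left, real_inner_smul_left, real_inner_smul_left, hbp₂,
    neg_sub] at hM₂
  -- Evaluating the dependency at `pᵢ` gives `lᵢ s ≤ 1 - lᵢ`.
  have hle := triangle_estimate hs hsum
    (by nlinarith [mul_le_mul_of_nonneg_left (hK₂ p₁ hp₁) hl₂,
      mul_le_mul_of_nonneg_left (hK₃ p₁ hp₁) hl₃])
    (by nlinarith [mul_le_mul_of_nonneg_left (hK₁ p₂ hp₂) hl₁,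
      mul_le_mul_of_nonneg_left (hK₃ p₂ hp₂) hl₃])
    (by nlinarith [mul_le_mul_of_nonneg_left (hK₁ p₃ hp₃) hl₁,
      mul_le_mul_of_nonneg_left (hK₂ p₃ hp₃) hl₂])
    (hK₃ p₁ hp₁) (hK₃ p₂ hp₂) e₁ e₂ hα hβ (hM₁.trans (le_max_left _ _))
    (hM₂.trans (le_max_right _ _))
  refine le_trans (mul_le_mul_of_nonneg_right ?_ (div_nonneg (by nlinarith) (by linarith))) hle
  have h₁ := hK₁ _ hx'
  have h₂ := hK₂ _ hx
  rw [inner_neg_right] at h₁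
  rw [inner_sub_left, real_inner_smul_left, real_inner_smul_left]
  nlinarith

/-- The `μ i` matter only modulo multiples of `l`. Subtracting the median ratio `μ i / l i` removes
one term and leaves the other two with opposite signs. -/
theorem inner_mul_le_of_triangle {K : Set E} (hK : IsCompact K) {s : ℝ} (hs : 1 < s)
    {b p : Fin 3 → E} {l : Fin 3 → ℝ} (hl : ∀ i, 0 < l i)
    (hsum : ∑ i, l i = 1) (hb : ∑ i, l i • b i = 0) (hp : ∀ i, p i ∈ K)
    (hbp : ∀ i, inner ℝ (b i) (p i) = s) (hbK : ∀ i, ∀ x ∈ K, -1 ≤ inner ℝ (b i) x)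
    (μ : Fin 3 → ℝ) {x : E} (hx : x ∈ K) (hx' : -x ∈ K) :
    inner ℝ (∑ i, μ i • b i) x * ((s ^ 2 - 1) / s) ≤
      max (supportFun K (∑ i, μ i • b i)) (supportFun K (-∑ i, μ i • b i)) := by
  set f : Fin 3 → ℝ := fun i => μ i / l i with hf
  set σ := Tuple.sort f
  have hmono : Monotone (f ∘ σ) := Tuple.monotone_sort f
  have h₀ : f (σ 0) ≤ f (σ 1) := hmono (by decide)
  have h₂ : f (σ 1) ≤ f (σ 2) := hmono (by decide)
  have hμ : ∀ i, μ i = l i * f i := fun i => by rw [hf]; field_simp [(hl i).ne']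
  rw [← Equiv.sum_comp σ, Fin.sum_univ_three] at hsum hb
  have hu : ∑ i, μ i • b i = (l (σ 2) * (f (σ 2) - f (σ 1))) • b (σ 2) -
      (l (σ 0) * (f (σ 1) - f (σ 0))) • b (σ 0) := by
    rw [← Equiv.sum_comp σ, Fin.sum_univ_three, hμ, hμ, hμ]
    have := congrArg (fun v => f (σ 1) • v) hb
    simp only [smul_zero] at this
    rw [← sub_zero (_ + _ + _), ← this]
    module
  rw [hu]
  exact inner_mul_le_of_triangle_pair hK hs (hl (σ 2)).le (hl (σ 0)).le (hl (σ 1)).le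
    (by linarith) (by rw [← hb]; abel) (hp _) (hp _) (hp _) (hbp _) (hbp _) (hbp _)
    (hbK _) (hbK _) (hbK _) (mul_nonneg (hl _).le (by linarith))
    (mul_nonneg (hl _).le (by linarith)) hx hx'

/-- For a planar Minkowski-centred body of asymmetry `s > 1`, the intersection `K ∩ -K` is
contained in `s / (s² - 1)` times the convex hull of `K ∪ -K`. -/
theorem inner_mul_le_max_supportFun [FiniteDimensional ℝ E] (hdim : Module.finrank ℝ E = 2)
    {K : Set E} (hK : IsCompact K) (hconv : Convex ℝ K) (h0 : (0 : E) ∈ interior K) {s : ℝ}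
    (hs : 1 < s) (hsub : ∀ u, supportFun K u ≤ s * supportFun K (-u))
    (hmin : ∀ ρ : ℝ, 0 < ρ → ∀ c : E, K - {c} ⊆ ρ • ({c} - K) → s ≤ ρ) (u : E)
    {x : E} (hx : x ∈ K) (hx' : -x ∈ K) :
    inner ℝ u x * ((s ^ 2 - 1) / s) ≤ max (supportFun K u) (supportFun K (-u)) := by
  have hne : K.Nonempty := ⟨0, interior_subset h0⟩
  obtain ⟨ι, _, z, w, hz, hind, hw, hw1, hwz⟩ := eq_pos_convex_span_of_mem_convexHull
    (zero_mem_convexHull_touching hK hconv h0 (by linarith) hsub hmin)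
  have hz' : ∀ i, ‖z i‖ = 1 ∧ supportFun K (z i) = s * supportFun K (-z i) :=
    fun i => hz ⟨i, rfl⟩
  obtain ⟨ε, hε, hεK⟩ := exists_pos_mul_norm_le_supportFun hK h0
  set m : ι → ℝ := fun i => supportFun K (-z i) with hm
  have hm0 : ∀ i, 0 < m i := fun i => by
    have := hεK (-z i)
    rw [norm_neg, (hz' i).1] at this
    linarith
  choose p hp hpz using fun i => hK.exists_inner_eq_supportFun hne (z i)
  -- Normalised so that `⟨b i, ·⟩` ranges over `[-1, s]` on `K`, with value `s` at `p i`.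
  set b : ι → E := fun i => (m i)⁻¹ • z i with hb
  have hmb : ∀ i, m i • b i = z i := fun i => by
    rw [hb]; simp [smul_smul, (hm0 i).ne']
  have hbp : ∀ i, inner ℝ (b i) (p i) = s := fun i => by
    rw [hb, real_inner_smul_left, hpz, (hz' i).2, mul_left_comm, inv_mul_cancel₀ (hm0 i).ne',
      mul_one]
  have hbK : ∀ i, ∀ x ∈ K, -1 ≤ inner ℝ (b i) x := fun i x hx => by
    have := hK.inner_le_supportFun (-z i) hx
    rw [inner_neg_left] at this
    rw [hb, real_inner_smul_left, inv_mul_eq_div, le_div_iff₀ (hm0 i)]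
    linarith
  have hι : Nonempty ι := by
    by_contra h
    rw [not_nonempty_iff] at h
    simp at hw1
  set W := ∑ i, w i * m i with hW
  have hW0 : 0 < W := Finset.sum_pos (fun i _ => mul_pos (hw i) (hm0 i)) Finset.univ_nonempty
  set l : ι → ℝ := fun i => w i * m i / W with hl
  have hl0 : ∀ i, 0 < l i := fun i => div_pos (mul_pos (hw i) (hm0 i)) hW0
  have hl1 : ∑ i, l i = 1 := by rw [hl, ← Finset.sum_div, div_self hW0.ne']
  have hlb : ∑ i, l i • b i = 0 := by
    have : ∀ i, l i • b i = W⁻¹ • w i • z i := fun i => by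
      conv_rhs => rw [← hmb i, smul_smul, smul_smul]
      simp only [hl, div_eq_inv_mul, mul_assoc]
    rw [Finset.sum_congr rfl fun i _ => this i, ← Finset.smul_sum, hwz, smul_zero]
  have hle : ∀ i, l i * (s + 1) ≤ 1 := fun i => by
    have h₁ : ∑ j, l j * inner ℝ (b j) (p i) = 0 := by
      simpa [sum_inner, real_inner_smul_left] using congrArg (fun v => inner ℝ v (p i)) hlb
    calc l i * (s + 1) = l i * (inner ℝ (b i) (p i) + 1) := by rw [hbp]
      _ ≤ ∑ j, l j * (inner ℝ (b j) (p i) + 1) :=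
        Finset.single_le_sum (f := fun j => l j * (inner ℝ (b j) (p i) + 1))
          (fun j _ => mul_nonneg (hl0 j).le (by linarith [hbK j _ (hp i)])) (Finset.mem_univ i)
      _ = 1 := by simp only [mul_add, mul_one, Finset.sum_add_distrib, h₁, hl1, zero_add]
  -- Affine independence in the plane allows at most three normals; weights at most `1/(s + 1)` with
  -- sum 1 force more than two.
  have hcard : Fintype.card ι = 3 := by
    apply le_antisymm
    · refine hind.card_le_finrank_succ.trans ?_
      have := Submodule.finrank_le (vectorSpan ℝ (Set.range z))
      omega
    · have h₁ : s + 1 ≤ Fintype.card ι := by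
        calc s + 1 = ∑ i, l i * (s + 1) := by rw [← Finset.sum_mul, hl1, one_mul]
          _ ≤ ∑ _i : ι, 1 := Finset.sum_le_sum fun i _ => hle i
          _ = Fintype.card ι := by simp
      have h₂ : (2 : ℝ) < Fintype.card ι := by linarith
      exact_mod_cast h₂
  obtain ⟨μ, rfl⟩ : ∃ μ : ι → ℝ, u = ∑ i, μ i • b i := by
    have htop := (hind.affineSpan_eq_top_iff_card_eq_finrank_add_one).2 (by rw [hcard, hdim])
    obtain ⟨ω, hω, hu⟩ := eq_affineCombination_of_mem_affineSpan_of_fintype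
      (htop ▸ AffineSubspace.mem_top ℝ E u : u ∈ affineSpan ℝ (Set.range z))
    rw [Finset.affineCombination_eq_linear_combination _ _ _ hω] at hu
    exact ⟨fun i => ω i * m i, by simp_rw [mul_smul, hmb]; exact hu⟩
  let e := (Fintype.equivFinOfCardEq hcard).symm
  have := inner_mul_le_of_triangle hK hs (b := b ∘ e) (p := p ∘ e) (l := l ∘ e)
    (fun i => hl0 _) (by rw [← hl1]; exact Equiv.sum_comp e l)
    (by rw [← hlb]; exact Equiv.sum_comp e fun i => l i • b i)
    (fun i => hp _) (fun i => hbp _) (fun i => hbK _) (μ ∘ e) hx hx'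
  rwa [show ∑ i, (μ ∘ e) i • (b ∘ e) i = ∑ i, μ i • b i from
    Equiv.sum_comp e fun i => μ i • b i] at this

end Asymmetry

/-! ### Inradius, circumradius and width of pseudo-complete bodies. -/

section PseudoComplete

variable {E : Type*} [NormedAddCommGroup E] [InnerProductSpace ℝ E]

theorem IsFullConvexBody.nonempty {K : Set E} (hK : IsFullConvexBody K) : K.Nonempty :=
  hK.2.2.mono interior_subset

theorem supportFun_pos {C : Set E} (hC : IsFullConvexBody C) (hCsymm : -C = C) {u : E}
    (hu : u ≠ 0) : 0 < supportFun C u := by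
  obtain ⟨ε, hε, h⟩ := exists_pos_mul_norm_le_supportFun hC.2.1
    (hC.1.zero_mem_interior_of_symm hCsymm hC.2.2)
  exact (mul_pos hε (norm_pos_iff.2 hu)).trans_le (h u)

theorem supportFun_zero (K : Set E) : supportFun K 0 = 0 := by
  simpa using supportFun_smul K le_rfl (0 : E)

theorem supportFun_add_le_relDiameter_mul {K C : Set E} (hK : IsFullConvexBody K)
    (hC : IsFullConvexBody C) (hCsymm : -C = C) (u : E) :
    supportFun K u + supportFun K (-u) ≤ relDiameter K C * supportFun C u := by
  rcases eq_or_ne u 0 with rfl | hu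
  · simp [supportFun_zero]
  obtain ⟨ε, hε, h⟩ := exists_pos_mul_norm_le_supportFun hC.2.1
    (hC.1.zero_mem_interior_of_symm hCsymm hC.2.2)
  obtain ⟨B, hB⟩ := hK.2.1.isBounded.exists_norm_le
  have hle : ∀ v, supportFun K v ≤ ‖v‖ * B := fun v => supportFun_le hK.nonempty fun x hx =>
    (real_inner_le_norm v x).trans (mul_le_mul_of_nonneg_left (hB x hx) (norm_nonneg v))
  -- Without boundedness the supremum would take the default value 0.
  have hbdd : BddAbove {b : ℝ | ∃ u : E, u ≠ 0 ∧ b = breadth u K C} := by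
    refine ⟨2 * B / ε, ?_⟩
    rintro _ ⟨v, hv, rfl⟩
    have h₁ := hle v
    have h₂ := hle (-v)
    rw [norm_neg] at h₂
    have hB0 : 0 ≤ B := (norm_nonneg _).trans (hB _ hK.nonempty.some_mem)
    rw [hK.2.1.breadth_eq hK.nonempty, div_le_iff₀ (supportFun_pos hC hCsymm hv)]
    calc _ ≤ 2 * B / ε * (ε * ‖v‖) := by field_simp; linarith
      _ ≤ _ := mul_le_mul_of_nonneg_left (h v) (by positivity)
  rw [← div_le_iff₀ (supportFun_pos hC hCsymm hu), ← hK.2.1.breadth_eq hK.nonempty]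
  exact le_csSup hbdd ⟨u, hu, rfl⟩

/-- The inradius is positive and attained. -/
theorem exists_inradius_smul_subset [Nontrivial E] {K C : Set E} (hK : IsFullConvexBody K)
    (hC : IsFullConvexBody C) (hCsymm : -C = C) :
    0 < inradius K C ∧ ∃ t : E, inradius K C • C ⊆ K + {t} := by
  have h0C : (0 : E) ∈ C := interior_subset (hC.1.zero_mem_interior_of_symm hCsymm hC.2.2)
  have hiff : ∀ (ρ : ℝ) (t : E), ρ • C ⊆ K + {t} ↔ ∀ x ∈ C, ρ • x - t ∈ K := fun ρ t => by
    rw [Set.smul_set_subset_iff]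
    refine forall₂_congr fun x _ => ?_
    simp [Set.add_singleton, sub_eq_add_neg]
  -- Admitting `ρ = 0` makes the set closed; it is bounded because `0 ∈ C` puts `-t` in `K`, and the
  -- breadth in one direction limits `ρ`.
  set T : Set (ℝ × E) := {p | 0 ≤ p.1 ∧ ∀ x ∈ C, p.1 • x - p.2 ∈ K} with hT
  have hTclosed : IsClosed T := by
    have : T = {p | 0 ≤ p.1} ∩ ⋂ x ∈ C, {p : ℝ × E | p.1 • x - p.2 ∈ K} := by
      ext p; simp [hT]
    rw [this]
    exact (isClosed_le continuous_const continuous_fst).inter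
      (isClosed_biInter fun x _ => hK.2.1.isClosed.preimage (by fun_prop))
  obtain ⟨u, hu⟩ := exists_ne (0 : E)
  have hCu := supportFun_pos hC hCsymm hu
  have hTsub : T ⊆ Set.Icc 0 ((supportFun K u + supportFun K (-u)) / (2 * supportFun C u)) ×ˢ
      (-K) := by
    rintro ⟨ρ, t⟩ ⟨hρ, h⟩
    refine ⟨⟨hρ, ?_⟩, by simpa using h 0 h0C⟩
    rw [le_div_iff₀ (by positivity)]
    have key : ∀ v, ρ * supportFun C v - inner ℝ v t ≤ supportFun K v := fun v => by
      obtain ⟨x, hx, hxv⟩ := hC.2.1.exists_inner_eq_supportFun hC.nonempty v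
      have := hK.2.1.inner_le_supportFun v (h x hx)
      rwa [inner_sub_right, real_inner_smul_right, hxv] at this
    have h₁ := key u
    have h₂ := key (-u)
    rw [supportFun_neg_of_symm hCsymm, inner_neg_left] at h₂
    linarith
  have hTcomp : IsCompact T := (isCompact_Icc.prod hK.2.1.neg).of_isClosed_subset hTclosed hTsub
  obtain ⟨ρ₀, hρ₀, t₀, ht₀⟩ : ∃ ρ : ℝ, 0 < ρ ∧ ∃ t : E, (ρ, t) ∈ T := by
    obtain ⟨y, hy⟩ := hK.2.2
    obtain ⟨δ, hδ, hball⟩ :=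
      Metric.nhds_basis_closedBall.mem_iff.1 (mem_interior_iff_mem_nhds.1 hy)
    obtain ⟨B, hB0, hB⟩ := hC.2.1.isBounded.exists_pos_norm_le
    refine ⟨δ / B, by positivity, -y, by positivity, fun x hx => hball ?_⟩
    rw [mem_closedBall_iff_norm, sub_neg_eq_add, add_sub_cancel_right, norm_smul,
      Real.norm_of_nonneg (by positivity), div_mul_eq_mul_div, div_le_iff₀ hB0]
    exact mul_le_mul_of_nonneg_left (hB x hx) hδ.le
  obtain ⟨⟨r, t⟩, hrt, hmax⟩ := hTcomp.exists_isMaxOn ⟨_, ht₀⟩ continuous_fst.continuousOn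
  have hr : 0 < r := hρ₀.trans_le (hmax ht₀)
  have hgreatest : inradius K C = r := by
    apply IsGreatest.csSup_eq
    refine ⟨⟨hr, t, (hiff r t).2 hrt.2⟩, ?_⟩
    rintro ρ ⟨hρ, t', ht'⟩
    exact hmax (show (ρ, t') ∈ T from ⟨hρ.le, (hiff ρ t').1 ht'⟩)
  rw [hgreatest]
  exact ⟨hr, t, (hiff r t).2 hrt.2⟩

theorem minkowskiAsymmetry_le {K : Set E} {ρ : ℝ} (hρ : 0 < ρ) {c : E}
    (h : K - {c} ⊆ ρ • ({c} - K)) : minkowskiAsymmetry K ≤ ρ :=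
  csInf_le ⟨0, fun _ hx => hx.1.le⟩ ⟨hρ, c, h⟩

/-- The bound `R(K, C) ≤ ρ / (ρ + 1) D(K, C)` for every `ρ` with `K - c ⊆ ρ (c - K)`. -/
theorem circumradius_mul_le [CompleteSpace E] [Nontrivial E] {K C : Set E}
    (hK : IsFullConvexBody K) (hC : IsFullConvexBody C) (hCsymm : -C = C)
    (hD : 0 < relDiameter K C) {ρ : ℝ} (hρ : 0 < ρ) {c : E} (h : K - {c} ⊆ ρ • ({c} - K)) :
    circumradius K C * (ρ + 1) ≤ ρ * relDiameter K C := by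
  rw [sub_subset_smul_iff hK.2.1 hK.1 hK.nonempty hρ] at h
  rw [← le_div_iff₀ (by linarith)]
  set R := ρ * relDiameter K C / (ρ + 1) with hR
  have hR0 : 0 < R := by positivity
  refine csInf_le ⟨0, fun _ hx => hx.1.le⟩ ⟨hR0, c, fun x hx => ?_⟩
  refine ⟨x - c, ⟨R⁻¹ • (x - c), ?_, by simp [smul_smul, hR0.ne']⟩, c, rfl, sub_add_cancel x c⟩
  refine mem_of_forall_inner_le_supportFun hC.2.1 hC.1 hC.nonempty fun u => ?_
  have h₁ := h u
  have h₂ := supportFun_add_le_relDiameter_mul hK hC hCsymm u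
  have h₃ := hK.2.1.inner_le_supportFun u hx
  rw [real_inner_smul_right, inner_sub_right, inv_mul_le_iff₀ hR0, hR, div_mul_eq_mul_div,
    le_div_iff₀ (by linarith)]
  -- Adding `ρ(h_K(u) - ⟨u, c⟩)` to both sides of `h₁` gives `(ρ + 1)(h_K(u) - ⟨u, c⟩) ≤ ρ(h_K(u) +
  -- h_K(-u))`.
  nlinarith [mul_le_mul_of_nonneg_left h₂ hρ.le]

/-- In a pseudo-complete body, after a translation the inball and the circumball are concentric
with centre a Minkowski centre, and `D(K, C) = (s(K) + 1) r(K, C)`. -/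
theorem IsPseudoComplete.exists_centre [CompleteSpace E] [Nontrivial E] {K C : Set E}
    (hK : IsFullConvexBody K) (hC : IsFullConvexBody C) (hCsymm : -C = C)
    (hKC : IsPseudoComplete K C) :
    ∃ t : E, 0 < inradius K C ∧ 1 ≤ minkowskiAsymmetry K ∧ inradius K C • C ⊆ K + {t} ∧
      relDiameter K C = (minkowskiAsymmetry K + 1) * inradius K C ∧
      ∀ u, supportFun (K + {t}) u ≤ minkowskiAsymmetry K * supportFun (K + {t}) (-u) := by
  obtain ⟨hr, t, ht⟩ := exists_inradius_smul_subset hK hC hCsymm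
  refine ⟨t, hr, ?_⟩
  have hne := hK.nonempty
  have hcomp : IsCompact (K + {t}) := hK.2.1.add isCompact_singleton
  set r := inradius K C with hrdef
  set D := relDiameter K C with hDdef
  set s := minkowskiAsymmetry K with hsdef
  set h := supportFun (K + {t}) with hh
  have hKt : ∀ u, h u = supportFun K u + inner ℝ u t := hK.2.1.supportFun_add_singleton hne t
  have hrC : ∀ u, r * supportFun C u ≤ h u := fun u => by
    obtain ⟨x, hx, hxu⟩ := hC.2.1.exists_inner_eq_supportFun hC.nonempty u
    have := hcomp.inner_le_supportFun u (ht ⟨x, hx, rfl⟩)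
    rwa [real_inner_smul_right, hxu] at this
  have hRC : ∀ u, h u ≤ (D - r) * supportFun C u := fun u => by
    have h₁ := supportFun_add_le_relDiameter_mul hK hC hCsymm u
    have h₂ := hrC (-u)
    rw [supportFun_neg_of_symm hCsymm, hKt, inner_neg_left] at h₂
    rw [hKt]
    linarith
  obtain ⟨v, hv⟩ := exists_ne (0 : E)
  have hrR : r ≤ D - r :=
    le_of_mul_le_mul_right ((hrC v).trans (hRC v)) (supportFun_pos hC hCsymm hv)
  have hR0 : 0 < D - r := hr.trans_le hrR
  have hcent : ∀ u, h u ≤ (D - r) / r * h (-u) := fun u => by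
    refine (hRC u).trans ?_
    have := hrC (-u)
    rw [supportFun_neg_of_symm hCsymm] at this
    rw [div_mul_eq_mul_div, le_div_iff₀ hr, mul_assoc]
    exact mul_le_mul_of_nonneg_left (by linarith) hR0.le
  have hmem : K - {-t} ⊆ ((D - r) / r) • ({-t} - K) := by
    refine (sub_subset_smul_iff hK.2.1 hK.1 hne (div_pos hR0 hr) _).2 fun u => ?_
    have := hcent u
    simp only [hKt, inner_neg_left] at this
    simpa only [inner_neg_right, sub_neg_eq_add] using this
  -- For the lower bound, `R(ρ + 1) ≤ ρD` with `D = r + R` reads `R ≤ ρr`.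
  have hs : s = (D - r) / r := by
    refine le_antisymm (minkowskiAsymmetry_le (div_pos hR0 hr) hmem)
      (le_csInf ⟨_, div_pos hR0 hr, _, hmem⟩ ?_)
    rintro ρ ⟨hρ, c, hc⟩
    have h₁ := circumradius_mul_le hK hC hCsymm (by linarith) hρ hc
    have h₂ : r + circumradius K C = D := hKC
    rw [div_le_iff₀ hr, ← h₂]
    rw [← hDdef, ← h₂] at h₁
    linarith
  refine ⟨?_, ht, ?_, fun u => hs ▸ hcent u⟩
  · rw [hs, le_div_iff₀ hr]; linarith
  · rw [hs]; field_simp; ring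

theorem two_mul_le_breadth {K C : Set E} (hK : IsFullConvexBody K)
    (hC : IsFullConvexBody C) (hCsymm : -C = C) {t : E} {r : ℝ} (ht : r • C ⊆ K + {t}) {u : E}
    (hu : u ≠ 0) : 2 * r ≤ breadth u K C := by
  have hcomp : IsCompact (K + {t}) := hK.2.1.add isCompact_singleton
  have key : ∀ u, r * supportFun C u ≤ supportFun K u + inner ℝ u t := fun u => by
    obtain ⟨x, hx, hxu⟩ := hC.2.1.exists_inner_eq_supportFun hC.nonempty u
    have := hcomp.inner_le_supportFun u (ht ⟨x, hx, rfl⟩)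
    rwa [real_inner_smul_right, hxu, hK.2.1.supportFun_add_singleton hK.nonempty] at this
  rw [hK.2.1.breadth_eq hK.nonempty, le_div_iff₀ (supportFun_pos hC hCsymm hu)]
  have h₁ := key u
  have h₂ := key (-u)
  rw [supportFun_neg_of_symm hCsymm, inner_neg_left] at h₂
  linarith

/-- A nonzero direction is needed, since the infimum of the empty set is 0. -/
theorem le_relWidth [Nontrivial E] {K C : Set E} {a : ℝ}
    (h : ∀ u : E, u ≠ 0 → a ≤ breadth u K C) : a ≤ relWidth K C := by
  obtain ⟨v, hv⟩ := exists_ne (0 : E)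
  refine le_csInf ⟨_, v, hv, rfl⟩ ?_
  rintro _ ⟨u, hu, rfl⟩
  exact h u hu

theorem IsPseudoComplete.relDiameter_div_relWidth_le [CompleteSpace E] [Nontrivial E]
    {K C : Set E} (hK : IsFullConvexBody K) (hC : IsFullConvexBody C) (hCsymm : -C = C)
    (hKC : IsPseudoComplete K C) :
    relDiameter K C / relWidth K C ≤ (minkowskiAsymmetry K + 1) / 2 := by
  obtain ⟨t, hr, hs, ht, hD, -⟩ := IsPseudoComplete.exists_centre hK hC hCsymm hKC
  have hw : 2 * inradius K C ≤ relWidth K C :=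
    le_relWidth fun u hu => two_mul_le_breadth hK hC hCsymm ht hu
  rw [div_le_iff₀ (by linarith), hD]
  nlinarith

theorem IsPseudoComplete.relDiameter_div_relWidth_le_of_finrank_eq_two [FiniteDimensional ℝ E]
    (hdim : Module.finrank ℝ E = 2) {K C : Set E} (hK : IsFullConvexBody K)
    (hC : IsFullConvexBody C) (hCsymm : -C = C) (hKC : IsPseudoComplete K C)
    (hs1 : minkowskiAsymmetry K ≠ 1) :
    relDiameter K C / relWidth K C ≤
      minkowskiAsymmetry K ^ 2 / (minkowskiAsymmetry K ^ 2 - 1) := by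
  have : Nontrivial E := Module.nontrivial_of_finrank_pos (R := ℝ) (by omega)
  obtain ⟨t, hr, hs, ht, hD, hcent⟩ := IsPseudoComplete.exists_centre hK hC hCsymm hKC
  set s := minkowskiAsymmetry K with hsdef
  set r := inradius K C with hrdef
  have hs' : 1 < s := lt_of_le_of_ne hs (Ne.symm hs1)
  have hq : 0 < s ^ 2 - 1 := by nlinarith
  have hne := hK.nonempty
  have hcomp : IsCompact (K + {t}) := hK.2.1.add isCompact_singleton
  have hconv : Convex ℝ (K + {t}) := hK.1.add (convex_singleton t)
  have hne' : (K + {t}).Nonempty := hne.add (Set.singleton_nonempty t)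
  have hKt := hK.2.1.supportFun_add_singleton hne t
  have h0 : (0 : E) ∈ interior (K + {t}) := by
    refine interior_mono ht ?_
    rw [interior_smul₀ hr.ne']
    exact ⟨0, hC.1.zero_mem_interior_of_symm hCsymm hC.2.2, smul_zero r⟩
  -- Asymmetry is translation invariant: a centre `c` of `K + {t}` becomes `c - t` for `K`.
  have hmin : ∀ ρ : ℝ, 0 < ρ → ∀ c : E,
      (K + {t}) - {c} ⊆ ρ • ({c} - (K + {t})) → s ≤ ρ := by
    intro ρ hρ c hc
    refine minkowskiAsymmetry_le (c := c - t) hρ ?_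
    rw [sub_subset_smul_iff hcomp hconv hne' hρ] at hc
    refine (sub_subset_smul_iff hK.2.1 hK.1 hne hρ _).2 fun u => ?_
    have := hc u
    rw [hKt, hKt, inner_neg_left] at this
    rw [inner_sub_right]
    convert this using 1 <;> ring
  have hw : relDiameter K C * ((s ^ 2 - 1) / s ^ 2) ≤ relWidth K C := by
    refine le_relWidth fun u hu => ?_
    obtain ⟨x, hx, hxu⟩ := hC.2.1.exists_inner_eq_supportFun hC.nonempty u
    have hx' : -x ∈ C := by rw [← hCsymm]; simpa using hx
    have key := inner_mul_le_max_supportFun hdim hcomp hconv h0 hs' hcent hmin u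
      (ht ⟨x, hx, rfl⟩) (by simpa using ht ⟨-x, hx', rfl⟩)
    simp only [real_inner_smul_right] at key
    rw [hxu] at key
    rw [hK.2.1.breadth_eq hne, le_div_iff₀ (supportFun_pos hC hCsymm hu)]
    have hsum : supportFun K u + supportFun K (-u) =
        supportFun (K + {t}) u + supportFun (K + {t}) (-u) := by
      rw [hKt, hKt, inner_neg_left]; ring
    have h₁ := hcent u
    have h₂ := hcent (-u)
    rw [neg_neg] at h₂
    rw [hsum, hD]
    -- By `hcent` in both directions the maximum is at most `s` times the minimum.
    have hmax : (s + 1) * max (supportFun (K + {t}) u) (supportFun (K + {t}) (-u)) ≤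
        s * (supportFun (K + {t}) u + supportFun (K + {t}) (-u)) := by
      rcases max_choice (supportFun (K + {t}) u) (supportFun (K + {t}) (-u)) with h | h <;>
        rw [h] <;> linarith
    have h₃ := (mul_le_mul_of_nonneg_left key (by linarith : 0 ≤ s + 1)).trans hmax
    rw [← mul_le_mul_iff_right₀ (by linarith : 0 < s)]
    refine le_trans (le_of_eq ?_) h₃
    field_simp
  have hD0 : 0 < relDiameter K C := by rw [hD]; positivity
  have hw0 : 0 < relWidth K C := lt_of_lt_of_le (by positivity) hw
  rw [div_le_div_iff₀ hw0 hq]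
  rw [← mul_div_assoc, div_le_iff₀ (by positivity)] at hw
  linarith

end PseudoComplete

/-! ### The main theorem. -/

/-- For `s(K) = 1` the term `s(K)² / (s(K)² - 1)` is `+∞`, so only `(s(K) + 1) / 2` remains in the
minimum. The last two parts identify the absolute bound: it is about `1.42`, and it is
`(s + 1) / 2` for the unique `s > 1` at which the two terms of the minimum agree. -/
theorem theorem1p4 (K C : Set (EuclideanSpace ℝ (Fin 2)))
    (hK : IsFullConvexBody K) (hC : IsFullConvexBody C) (hCsymm : -C = C)
    (hKC : IsPseudoComplete K C) :
    relDiameter K C / relWidth K C ≤ (minkowskiAsymmetry K + 1) / 2 ∧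
    (minkowskiAsymmetry K ≠ 1 →
      relDiameter K C / relWidth K C
        ≤ min ((minkowskiAsymmetry K + 1) / 2)
            (minkowskiAsymmetry K ^ 2 / (minkowskiAsymmetry K ^ 2 - 1))) ∧
    relDiameter K C / relWidth K C ≤ ratioBound ∧
    |ratioBound - 1.42| < 0.005 ∧
    (∀ s : ℝ, 1 < s → ((s + 1) / 2 = s ^ 2 / (s ^ 2 - 1) ↔ ratioBound = (s + 1) / 2)) := by
  have hdim : Module.finrank ℝ (EuclideanSpace ℝ (Fin 2)) = 2 := by simp
  have h₁ := IsPseudoComplete.relDiameter_div_relWidth_le hK hC hCsymm hKC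
  have h₂ := IsPseudoComplete.relDiameter_div_relWidth_le_of_finrank_eq_two hdim hK hC hCsymm hKC
  obtain ⟨-, -, hs, -⟩ := IsPseudoComplete.exists_centre hK hC hCsymm hKC
  refine ⟨h₁, fun h => le_min h₁ (h₂ h), le_ratioBound hs h₁ h₂, ?_,
    fun s hs => ratioBound_eq_iff hs⟩
  have := ratioBound_mem
  rw [abs_lt]
  constructor <;> linarith
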